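/- **Dynamical networks.** Let $\mathcal I$ be a finite index set and let $(X_i,d)$, $i\in\mathcal I$, be complete metric spaces. A *dynamical network* $(\mathcal F,X)$ on $X=\prod_i X_i$ consists of maps $\varphi_i:X_i\to X_i$ with $L_i=\sup_{x\ne y} d(\varphi_i(x),\varphi_i(y))/d(x,y)<\infty$ (the supremum over the empty set being $0$) and an interaction $F:X\to X$, $F(\mathbf x)_j=F_j(\mathbf x|_{\mathcal I_j})$, given by nonempty sets $\mathcal I_j\subseteq\mathcal I$ and continuous maps $F_j:\prod_{i\in\mathcal I_j}X_i\to X_j$; put $\mathcal F=F\circ\varphi$, with components $\mathcal F_j$, which are functions of the variables $x_i$, $i\in\mathcal I_j$. The network has *no local dynamics* if all $\varphi_i$ are identity maps. A *stability matrix* of $(\mathcal F,X)$ is a matrix $\Lambda^T\operatorname{diag}(L_i)$, where $\Lambda_{ij}\ge 0$, $\Lambda_{ij}=0$ for $i\notin\mathcal I_j$, and $d(F_j(\mathbf x|_{\mathcal I_j}),F_j(\mathbf y|_{\mathcal I_j}))\le\sum_{i\in\mathcal I_j}\Lambda_{ij}\,d(x_i,y_i)$ for all $j\in\mathcal I$ and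 $\mathbf x,\mathbf y\in X$. The spectral radius $\rho(A)$ of a real square matrix $A$ is the largest modulus of its complex eigenvalues. **Structural sets.** The graph of interactions $\Gamma_{\mathcal F}$ has vertex set $\mathcal I$ and an edge $i\to j$ whenever $i\in\mathcal I_j$. Paths (with at least one edge) have distinct vertices; cycles, including loops, have distinct vertices except that the first and the last one coincide. A set $S\subseteq\mathcal I$ is a *complete structural set* if every cycle contains a vertex of $S$ and every vertex belongs to a path or cycle that begins and ends in $S$. For $i,j\in S$ let $\mathcal B_{ij}$ be the set of paths and cycles from $i$ to $j$ without interior vertices in $S$; these are called *branches*. A complete structural set $S$ is *basic* if $|\mathcal B_{ij}|\le 1$ for all $i,j\in S$. **Restriction and expansion.** Let $S$ be a complete structural set. For $j\in S$, replace in $\mathcal F_j$ every variable $x_u$ with $u\notin S$ by the function $\mathcal F_u$, and repeat this until all variables are indexed by $S$. Each occurrence of a variable in the resulting function is reached through a unique branch $\gamma=\ell_1,\dots,\ell_N$ with $\ell_N=j$, and it is an occurrence of $x_{\ell_1}$. * The *restriction* $(\mathcal R_S\mathcal F,X|_S)$ is the network without local dynamics on $X|_S=\prod_{j\in S}X_j$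 whose $j$-th component is this function of the variables $x_i$, where $i$ runs over the $i\in S$ with $\mathcal B_{ij}\neq\emptyset$. * The *expansion* $(\mathcal X_S\mathcal F,X_S)$ is the network without local dynamics on $X_S=\prod_{j\in S}X_j\times\prod_{(i;\gamma)}X_{i;\gamma}$, where $\gamma=\ell_1,\dots,\ell_N$ runs over the branches with $N>2$, $1<i<N$, and $X_{i;\gamma}=X_{\ell_1}$. Write $x_{1;\gamma}=x_{\ell_1}$. For $j\in S$ its $j$-th component is the above function with each occurrence reached through $\gamma=\ell_1,\dots,\ell_N$ taken to be the variable $x_{N-1;\gamma}$ (so it remains $x_{\ell_1}$ if $N=2$); its variables are the $x_{N-1;\gamma}$ for the branches $\gamma$ that end at $j$. Its $(i;\gamma)$-th component is $x_{i-1;\gamma}$, which is the only variable of that component. **Theorem 6.5.** Let $(\mathcal F,X)$ be a dynamical network and let $S$ be a basic structural set of $\Gamma_{\mathcal F}$. There is a stability matrix $A$ of the expansion $(\mathcal X_S\mathcal F,X_S)$ with $\rho(A)<1$ if and only if there is a stability matrix $B$ of the restriction $(\mathcal R_S\mathcal F,X|_S)$ with $\rho(B)<1$. -/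

import Mathlib

noncomputable section

namespace Delay

/-! ### Dynamical networks -/

/-- The set of difference quotients of a self-map of a metric space. -/
def lipRatios {Y : Type*} [MetricSpace Y] (f : Y → Y) : Set ℝ :=
  {r | ∃ x y : Y, x ≠ y ∧ r = dist (f x) (f y) / dist x y}

/-- `L = sup_{x ≠ y} d(f x, f y) / d(x, y)` (equal to `0` on a space with at most one point). -/
def lipConst {Y : Type*} [MetricSpace Y] (f : Y → Y) : ℝ := sSup (lipRatios f)

/-- A dynamical network on the product of the complete metric spaces `X i`: local maps `φ i` with
finite Lipschitz constants, and an interaction, given by a nonempty index set `idx j` and a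
continuous map `F j : ∏_{i ∈ idx j} X i → X j` for every `j`. -/
structure DynamicalNetwork {ι : Type*} (X : ι → Type*) [∀ i, MetricSpace (X i)]
    [∀ i, CompleteSpace (X i)] where
  φ : ∀ i, X i → X i
  φ_lip : ∀ i, BddAbove (lipRatios (φ i))
  idx : ι → Set ι
  idx_nonempty : ∀ j, (idx j).Nonempty
  F : ∀ j, (∀ i : idx j, X i) → X j
  F_cont : ∀ j, Continuous (F j)

theorem continuous_of_lipRatios {Y : Type*} [MetricSpace Y] {f : Y → Y}
    (h : BddAbove (lipRatios f)) : Continuous f := by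
  obtain ⟨K, hK⟩ := h
  refine (LipschitzWith.of_dist_le' (K := K) fun x y => ?_).continuous
  rcases eq_or_ne x y with rfl | hxy
  · simp
  · exact (div_le_iff₀ (dist_pos.2 hxy)).1 (hK ⟨x, y, hxy, rfl⟩)

theorem bddAbove_lipRatios_id {Y : Type*} [MetricSpace Y] :
    BddAbove (lipRatios (id : Y → Y)) := by
  refine ⟨1, ?_⟩
  rintro _ ⟨x, y, _, rfl⟩
  exact div_self_le_one _

/-- The spectral radius of a real matrix: the largest modulus of its complex eigenvalues. -/
def specRad {n : Type*} [Fintype n] [DecidableEq n] (A : Matrix n n ℝ) : ENNReal :=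
  spectralRadius ℂ (A.map (algebraMap ℝ ℂ))

/-! ### Paths and cycles in directed graphs -/

section Graph

variable {ι : Type*} (G : Digraph ι)

/-- The sequence `i, m₁, …, mₖ, j` is a path: consecutive vertices are joined by edges and all
vertices are distinct. -/
def IsPath (i : ι) (m : List ι) (j : ι) : Prop :=
  (i :: (m ++ [j])).IsChain G.Adj ∧ (i :: (m ++ [j])).Nodup

/-- The sequence `i, m₁, …, mₖ, i` is a cycle; for `m = []` this is a loop. -/
def IsCycle (i : ι) (m : List ι) : Prop :=
  (i :: (m ++ [i])).IsChain G.Adj ∧ (i :: m).Nodup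

/-- The sequence `i, m₁, …, mₖ, j` is a path or a cycle from `i` to `j`. -/
def IsPathOrCycle (i : ι) (m : List ι) (j : ι) : Prop :=
  IsPath G i m j ∨ (i = j ∧ IsCycle G i m)

/-- `S` is a complete structural set: every cycle contains a vertex of `S`, and every vertex
belongs to a path or cycle that begins and ends in `S`. -/
structure IsCompleteStructuralSet (S : Finset ι) : Prop where
  hits : ∀ i m, IsCycle G i m → ∃ v ∈ i :: m, v ∈ S
  covers : ∀ v, ∃ i ∈ S, ∃ j ∈ S, ∃ m, IsPathOrCycle G i m j ∧ v ∈ i :: (m ++ [j])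

/-- The branch set of `S`: a branch is a path or cycle `src, mid, tgt` that begins and ends in `S`
and has no interior vertex in `S`. -/
@[ext] structure Branch (S : Finset ι) where
  src : ι
  mid : List ι
  tgt : ι
  src_mem : src ∈ S
  tgt_mem : tgt ∈ S
  isPathOrCycle : IsPathOrCycle G src mid tgt
  mid_notMem : ∀ v ∈ mid, v ∉ S

/-- `S` is a basic structural set: a complete structural set such that there is at most one branch
from `i` to `j`, for all `i, j ∈ S`. -/
structure IsBasicStructuralSet (S : Finset ι) : Prop extends IsCompleteStructuralSet G S where
  basic : ∀ i ∈ S, ∀ j ∈ S, {γ : Branch G S | γ.src = i ∧ γ.tgt = j}.encard ≤ 1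

variable {G} {S : Finset ι}

theorem nodup_of_chain (hS : IsCompleteStructuralSet G S) :
    ∀ m : List ι, m.IsChain G.Adj → (∀ v ∈ m, v ∉ S) → m.Nodup
  | [], _, _ => List.nodup_nil
  | v :: m, hc, hm => by
    have ih : m.Nodup := nodup_of_chain hS m hc.tail fun w hw => hm w (List.mem_cons_of_mem _ hw)
    refine List.nodup_cons.2 ⟨fun hv => ?_, ih⟩
    obtain ⟨a, b, rfl⟩ := List.append_of_mem hv
    have hcyc : IsCycle G v a := by
      refine ⟨?_, ?_⟩
      · have h1 : v :: (a ++ v :: b) = (v :: (a ++ [v])) ++ b := by simp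
        rw [h1] at hc
        exact hc.left_of_append
      · rw [List.nodup_append] at ih
        refine List.nodup_cons.2 ⟨fun h => ?_, ih.1⟩
        exact ih.2.2 v h v (by simp) rfl
    obtain ⟨w, hw, hwS⟩ := hS.hits v a hcyc
    refine hm w ?_ hwS
    simp only [List.mem_cons, List.mem_append] at hw ⊢
    tauto

/-- `m, j` is the final part, with first vertex `v`, of a possible branch that ends at `j`; no
vertex of `S` has been reached yet. -/
structure IsStem (G : Digraph ι) (S : Finset ι) (v : ι) (m : List ι) (j : ι) : Prop where
  head : m.headD j = v
  chain : (m ++ [j]).IsChain G.Adj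
  notMem : ∀ w ∈ m, w ∉ S

theorem isStem_nil (j : ι) : IsStem G S j [] j := ⟨rfl, by simp, by simp⟩

section Stem

variable {m : List ι} {v j u : ι}

theorem IsStem.chain_cons (h : IsStem G S v m j) (hu : G.Adj u v) :
    (u :: (m ++ [j])).IsChain G.Adj := by
  obtain ⟨rfl, hc, -⟩ := h
  cases m with
  | nil => simpa using hu
  | cons w m => exact List.IsChain.cons_cons hu hc

theorem IsStem.cons (h : IsStem G S v m j) (hu : G.Adj u v) (huS : u ∉ S) :
    IsStem G S u (u :: m) j := by
  refine ⟨rfl, h.chain_cons hu, fun v hv => ?_⟩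
  rcases List.mem_cons.1 hv with rfl | hv
  · exact huS
  · exact h.notMem v hv

theorem IsStem.nodup (h : IsStem G S v m j) (hS : IsCompleteStructuralSet G S) : m.Nodup :=
  nodup_of_chain hS m h.chain.left_of_append h.notMem

theorem IsStem.measure_lt [Fintype ι] (h : IsStem G S v (u :: m) j)
    (hS : IsCompleteStructuralSet G S) :
    Fintype.card ι - (u :: m).length < Fintype.card ι - m.length := by
  have := (h.nodup hS).length_le_card
  simp only [List.length_cons] at this ⊢
  omega

theorem IsStem.isPathOrCycle (h : IsStem G S v m j)
    (hS : IsCompleteStructuralSet G S) (hj : j ∈ S) (hu : G.Adj u v) (huS : u ∈ S) :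
    IsPathOrCycle G u m j := by
  have h1 := h.chain_cons hu
  have hn := h.nodup hS
  have hum : u ∉ m := fun hm => h.notMem u hm huS
  have hjm : j ∉ m := fun hm => h.notMem j hm hj
  by_cases huj : u = j
  · subst huj
    exact Or.inr ⟨rfl, h1, List.nodup_cons.2 ⟨hum, hn⟩⟩
  · refine Or.inl ⟨h1, List.nodup_cons.2 ⟨?_, ?_⟩⟩
    · simp [hum, huj]
    · rw [List.nodup_append]
      refine ⟨hn, by simp, ?_⟩
      rintro a ha b hb rfl
      exact hjm (by simpa using (List.mem_singleton.1 hb) ▸ ha)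

/-- The branch `u, m, j` completing the stem `m, j` by its first vertex `u ∈ S`. -/
abbrev IsStem.branch (h : IsStem G S v m j)
    (hS : IsCompleteStructuralSet G S) (hj : j ∈ S) (hu : G.Adj u v) (huS : u ∈ S) :
    Branch G S where
  src := u
  mid := m
  tgt := j
  src_mem := huS
  tgt_mem := hj
  isPathOrCycle := h.isPathOrCycle hS hj hu huS
  mid_notMem := h.notMem

end Stem

theorem Branch.mid_nodup (γ : Branch G S) : γ.mid.Nodup := by
  rcases γ.isPathOrCycle with h | h
  · exact (List.nodup_append.1 (List.nodup_cons.1 h.2).2).1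
  · exact (List.nodup_cons.1 h.2.2).2

instance [Finite ι] : Finite (Branch G S) := by
  have : Fintype ι := Fintype.ofFinite ι
  have hf : Finite {l : List ι // l.length ≤ Fintype.card ι} :=
    (List.finite_length_le ι (Fintype.card ι)).to_subtype
  refine Finite.of_injective
    (fun γ : Branch G S => ((γ.src, γ.tgt),
      (⟨γ.mid, γ.mid_nodup.length_le_card⟩ : {l : List ι // l.length ≤ Fintype.card ι}))) ?_
  intro γ δ h
  simp only [Prod.mk.injEq, Subtype.mk.injEq] at h
  exact Branch.ext h.1.1 h.2 h.1.2

end Graph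

/-! ### The index set and the space of the expansion -/

section Expansion

variable {ι : Type*} {X : ι → Type*} [∀ i, MetricSpace (X i)] {S : Finset ι}

/-- The index set of the expansion: `j ∈ S`, and one index for each branch
`γ = ℓ₁, …, ℓ_N` and each `1 < i < N`, here `i = k + 2` with `k < N - 2` (so there is no such
index when `N = 2`). -/
inductive ExpIdx (G : Digraph ι) (S : Finset ι) where
  | base (j : S) : ExpIdx G S
  | delay (γ : Branch G S) (k : Fin γ.mid.length) : ExpIdx G S

instance [Finite ι] (G : Digraph ι) (S : Finset ι) : Finite (ExpIdx G S) := by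
  refine Finite.of_surjective
    (fun c : S ⊕ (Σ γ : Branch G S, Fin γ.mid.length) =>
      (Sum.elim ExpIdx.base (fun p => ExpIdx.delay p.1 p.2) c : ExpIdx G S)) ?_
  rintro (j | ⟨γ, k⟩)
  · exact ⟨Sum.inl j, rfl⟩
  · exact ⟨Sum.inr ⟨γ, k⟩, rfl⟩

instance [Finite ι] (G : Digraph ι) (S : Finset ι) : Fintype (ExpIdx G S) := Fintype.ofFinite _

instance (G : Digraph ι) (S : Finset ι) : DecidableEq (ExpIdx G S) := Classical.decEq _

/-- The factors of the space of the expansion: `X j` for `j ∈ S`, and copies of `X ℓ₁` for the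
indices that belong to a branch `γ = ℓ₁, …, ℓ_N`. -/
def ExpSpace (X : ι → Type*) {G : Digraph ι} {S : Finset ι} : ExpIdx G S → Type _
  | .base j => X j
  | .delay γ _ => X γ.src

instance {G : Digraph ι} (c : ExpIdx G S) : MetricSpace (ExpSpace X c) :=
  match c with
  | .base j => inferInstanceAs (MetricSpace (X j))
  | .delay γ _ => inferInstanceAs (MetricSpace (X γ.src))

instance [∀ i, CompleteSpace (X i)] {G : Digraph ι} (c : ExpIdx G S) :
    CompleteSpace (ExpSpace X c) :=
  match c with
  | .base j => inferInstanceAs (CompleteSpace (X j))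
  | .delay γ _ => inferInstanceAs (CompleteSpace (X γ.src))

/-- The indices `(1; γ), …, (N - 1; γ)` along a branch `γ = ℓ₁, …, ℓ_N`, where `(1; γ)` is the
index `ℓ₁` itself, and `(N - 1; γ)` is the index `γ`; here `(k + 1; γ)` is `along γ k`. -/
def along {G : Digraph ι} (γ : Branch G S) (k : Fin (γ.mid.length + 1)) : ExpIdx G S :=
  Fin.cases (motive := fun _ => ExpIdx G S) (.base ⟨γ.src, γ.src_mem⟩) (fun i => .delay γ i) k

/-- The factor at each index along a branch `γ = ℓ₁, …, ℓ_N` is `X ℓ₁`; this is the identity. -/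
def toSrc {G : Digraph ι} (γ : Branch G S) (k : Fin (γ.mid.length + 1)) :
    ExpSpace X (along γ k) → X γ.src :=
  Fin.cases (motive := fun k => ExpSpace X (along γ k) → X γ.src) (fun a => a) (fun _ a => a) k

theorem toSrc_cont {G : Digraph ι} (γ : Branch G S) (k : Fin (γ.mid.length + 1)) :
    Continuous (toSrc (X := X) γ k) := by
  cases k using Fin.cases with
  | zero => exact continuous_id
  | succ i => exact continuous_id

end Expansion

namespace DynamicalNetwork

variable {ι : Type*} {X : ι → Type*} [∀ i, MetricSpace (X i)] [∀ i, CompleteSpace (X i)]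

/-- `A` is a stability matrix of the network: `A = Λᵀ · diag(L)`, where `L i` is the Lipschitz
constant of `φ i`, and `Λ` is a nonnegative matrix of Lipschitz constants of the interaction, with
`Λ i j = 0` unless `i ∈ idx j`. -/
def IsStabilityMatrix [Fintype ι] [DecidableEq ι] (N : DynamicalNetwork X)
    (A : Matrix ι ι ℝ) : Prop :=
  ∃ Λ : Matrix ι ι ℝ,
    (∀ i j, 0 ≤ Λ i j) ∧ (∀ i j, i ∉ N.idx j → Λ i j = 0) ∧
    (∀ (j : ι) (x y : ∀ i, X i),
      dist (N.F j fun i => x i) (N.F j fun i => y i) ≤ ∑ i, Λ i j * dist (x i) (y i)) ∧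
    A = Λ.transpose * Matrix.diagonal fun i => lipConst (N.φ i)

/-- The component `(F ∘ φ)_j` of the network, as a function of the variables `x i`, `i ∈ idx j`. -/
def comp (N : DynamicalNetwork X) (j : ι) (x : ∀ i : N.idx j, X i) : X j :=
  N.F j fun i => N.φ i (x i)

theorem comp_cont (N : DynamicalNetwork X) (j : ι) : Continuous (N.comp j) :=
  (N.F_cont j).comp (continuous_pi fun i =>
    (continuous_of_lipRatios (N.φ_lip i)).comp (continuous_apply i))

/-- The graph of interactions: there is an edge from `i` to `j` when `i ∈ idx j`. -/
def graph (N : DynamicalNetwork X) : Digraph ι where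
  Adj i j := i ∈ N.idx j

theorem adj (N : DynamicalNetwork X) {v : ι} (u : N.idx v) : N.graph.Adj (u : ι) v := u.2

variable {S : Finset ι} (N : DynamicalNetwork X)

/-- Iterated substitution. In `N.comp j` every variable `x u` with `u ∉ S` is replaced by the
function `N.comp u`, then the same is done in the functions that were inserted, and so on until
only variables indexed by `S` are left. An occurrence of a variable `x u`, `u ∈ S`, in the result
is reached from `j` through a unique branch `γ = u, m, j`, and there the value `val γ` is
inserted. The function below does this inside the copy of `N.comp v` that is reached through
`m`; here `v` is the first vertex of `m, j`, so `m = []` and `v = j` give the entire composition. -/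
def substFrom [Fintype ι] [DecidableEq ι]
    (hS : IsCompleteStructuralSet N.graph S) (j : ι) (hj : j ∈ S)
    (val : ∀ γ : Branch N.graph S, γ.tgt = j → X γ.src)
    (v : ι) (m : List ι) (hm : IsStem N.graph S v m j) : X v :=
  N.comp v fun u =>
    if hu : (u : ι) ∈ S then val (hm.branch hS hj (N.adj u) hu) rfl
    else substFrom hS j hj val u ((u : ι) :: m) (hm.cons (N.adj u) hu)
  termination_by Fintype.card ι - m.length
  decreasing_by exact (hm.cons (N.adj u) hu).measure_lt hS

/-- `N.comp j` with all variables outside `S` eliminated by iterated substitution, and with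
`val γ` as the value of the variable that is reached through the branch `γ`. -/
def subst [Fintype ι] [DecidableEq ι]
    (hS : IsCompleteStructuralSet N.graph S) (j : ι) (hj : j ∈ S)
    (val : ∀ γ : Branch N.graph S, γ.tgt = j → X γ.src) : X j :=
  N.substFrom hS j hj val j [] (isStem_nil j)

theorem substFrom_cont [Fintype ι] [DecidableEq ι]
    (hS : IsCompleteStructuralSet N.graph S) (j : ι) (hj : j ∈ S)
    {T : Type*} [TopologicalSpace T]
    (val : T → ∀ γ : Branch N.graph S, γ.tgt = j → X γ.src)
    (hval : ∀ γ h, Continuous fun t => val t γ h)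
    (v : ι) (m : List ι) (hm : IsStem N.graph S v m j) :
    Continuous fun t => N.substFrom hS j hj (val t) v m hm := by
  have key : (fun t => N.substFrom hS j hj (val t) v m hm) = fun t =>
      N.comp v fun u =>
        if hu : (u : ι) ∈ S then val t (hm.branch hS hj (N.adj u) hu) rfl
        else N.substFrom hS j hj (val t) u ((u : ι) :: m) (hm.cons (N.adj u) hu) := by
    funext t
    rw [substFrom]
  rw [key]
  refine (N.comp_cont _).comp (continuous_pi fun u => ?_)
  by_cases hu : (u : ι) ∈ S
  · refine (hval (hm.branch hS hj (N.adj u) hu) rfl).congr fun t => ?_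
    rw [dif_pos hu]
  · refine (substFrom_cont hS j hj val hval u ((u : ι) :: m) (hm.cons (N.adj u) hu)).congr
      fun t => ?_
    rw [dif_neg hu]
  termination_by Fintype.card ι - m.length
  decreasing_by exact (hm.cons (N.adj u) hu).measure_lt hS

theorem subst_cont [Fintype ι] [DecidableEq ι]
    (hS : IsCompleteStructuralSet N.graph S) (j : ι) (hj : j ∈ S)
    {T : Type*} [TopologicalSpace T]
    (val : T → ∀ γ : Branch N.graph S, γ.tgt = j → X γ.src)
    (hval : ∀ γ h, Continuous fun t => val t γ h) :
    Continuous fun t => N.subst hS j hj (val t) :=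
  N.substFrom_cont hS j hj val hval j [] (isStem_nil j)

theorem exists_branch_from [Fintype ι]
    (hS : IsCompleteStructuralSet N.graph S) (j : ι) (hj : j ∈ S)
    (v : ι) (m : List ι) (hm : IsStem N.graph S v m j) : ∃ γ : Branch N.graph S, γ.tgt = j := by
  obtain ⟨u, hu'⟩ := N.idx_nonempty v
  by_cases hu : u ∈ S
  · exact ⟨hm.branch hS hj hu' hu, rfl⟩
  · exact exists_branch_from hS j hj u (u :: m) (hm.cons hu' hu)
  termination_by Fintype.card ι - m.length
  decreasing_by exact (hm.cons hu' hu).measure_lt hS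

theorem exists_branch [Fintype ι] (hS : IsCompleteStructuralSet N.graph S) (j : ι) (hj : j ∈ S) :
    ∃ γ : Branch N.graph S, γ.tgt = j :=
  N.exists_branch_from hS j hj j [] (isStem_nil j)

/-! ### The restriction -/

/-- The restriction `(R_S F, X|_S)`, a network without local dynamics: its `j`-th component is
`N.comp j` with every variable outside `S` eliminated by iterated substitution, the remaining
variables being `x i` for those `i ∈ S` from which there is a branch to `j`. -/
def restriction [Fintype ι] [DecidableEq ι] (hS : IsCompleteStructuralSet N.graph S) :
    DynamicalNetwork (fun i : S => X i) where
  φ _ := id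
  φ_lip _ := bddAbove_lipRatios_id
  idx j := {i | ∃ γ : Branch N.graph S, γ.src = i ∧ γ.tgt = j}
  idx_nonempty j := by
    obtain ⟨γ, h⟩ := N.exists_branch hS j j.2
    exact ⟨⟨γ.src, γ.src_mem⟩, γ, rfl, h⟩
  F j x := N.subst hS j j.2 fun γ h => x ⟨⟨γ.src, γ.src_mem⟩, γ, rfl, h⟩
  F_cont j := N.subst_cont hS j j.2 _ fun _ _ => continuous_apply _

/-! ### The expansion -/

/-- The expansion `(X_S F, X_S)`, a network without local dynamics. For `j ∈ S` its component is
`N.comp j` with every variable outside `S` eliminated by iterated substitution, the variable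
that is reached through the branch `γ` being renamed to the one with index `γ`. The component with
index `(i; γ)`, `1 < i < N`, is the variable with index `(i - 1; γ)`. -/
def expansion [Fintype ι] [DecidableEq ι] (hS : IsCompleteStructuralSet N.graph S) :
    DynamicalNetwork (ExpSpace X (G := N.graph) (S := S)) where
  φ _ := id
  φ_lip _ := bddAbove_lipRatios_id
  idx c := match c with
    | .base j => {d | ∃ γ : Branch N.graph S, γ.tgt = j ∧ d = along γ (Fin.last _)}
    | .delay γ k => {along γ k.castSucc}
  idx_nonempty c := match c with
    | .base j => by
      obtain ⟨γ, h⟩ := N.exists_branch hS j j.2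
      exact ⟨along γ (Fin.last _), γ, h, rfl⟩
    | .delay γ k => ⟨_, rfl⟩
  F c := match c with
    | .base j => fun x =>
      N.subst hS j j.2 fun γ h => toSrc γ (Fin.last _) (x ⟨along γ (Fin.last _), γ, h, rfl⟩)
    | .delay γ k => fun x => toSrc γ k.castSucc (x ⟨along γ k.castSucc, rfl⟩)
  F_cont c := match c with
    | .base j => N.subst_cont hS j j.2 _
        fun γ _ => (toSrc_cont γ (Fin.last _)).comp (continuous_apply _)
    | .delay γ k => (toSrc_cont γ k.castSucc).comp (continuous_apply _)

end DynamicalNetwork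

end Delay

end

/-!
Both implications compare two nonnegative matrices through positive vectors instead of through
their characteristic polynomials. A nonnegative matrix `A` has spectral radius less than `1` if and
only if `A v < v` holds in every coordinate for some positive vector `v`
(`specRad_lt_one_of_mulVec_lt`, `exists_mulVec_lt_of_specRad_lt_one`). Stability of a network thus
means that there are Lipschitz constants `Λ` of the interaction and a positive vector `v` with
`∑ i, Λ i j * L i * v i < v j` for all `j` (`DynamicalNetwork.exists_isStabilityMatrix_iff`).

Since `S` is basic, the variables of the `j`-th component of the expansion, `j ∈ S`, correspond to
the variables `x i` of the `j`-th component of the restriction: `x i` is replaced by the variable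
with index `lastIdx i j`, at the end of the only branch from `i` to `j`
(`DynamicalNetwork.expansion_F_base`). So Lipschitz constants of the two components are the same
thing, and the other components of the expansion are isometries in one variable.

* Let `v` be a positive vector for the expansion. An isometry has Lipschitz constant at least `1`,
  so `v` does not decrease along a branch, and its part on `S` is a positive vector for the
  restriction. Two degenerate cases are separate: if the space has at most one point at a vertex,
  then `L = 0` there, and if the product space is empty, then all Lipschitz constants may be `0`.
* Let `w` be a positive vector for the restriction. All inequalities for `w` are strict, so they
  leave room for a vector on the indices of the expansion that equals `w` on `S` and grows by a
  small amount in every step along a branch (`alongVector`). This growth makes the inequalities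
  at the delay components strict.
-/

namespace Delay

/-! ### Spectral radii of nonnegative matrices -/

section SpectralRadius

variable {n : Type*} [Fintype n] [DecidableEq n] {A : Matrix n n ℝ}

attribute [local instance] Matrix.linftyOpNormedRing Matrix.linftyOpNormedAlgebra

/-- A nonnegative matrix that strictly decreases a positive vector contracts the supremum norm
weighted by that vector, so all its eigenvalues lie in the open unit disc. -/
theorem specRad_lt_one_of_mulVec_lt (hA : ∀ i j, 0 ≤ A i j) {v : n → ℝ} (hv : ∀ i, 0 < v i)
    (h : ∀ i, ∑ j, A i j * v j < v i) : specRad A < 1 := by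
  unfold specRad
  rcases isEmpty_or_nonempty n with hn | hn
  · rw [spectrum.SpectralRadius.of_subsingleton]
    exact zero_lt_one
  refine mod_cast spectrum.spectralRadius_lt_of_forall_lt (r := 1) _ fun z hz => ?_
  rw [← Matrix.spectrum_toLin', ← Module.End.hasEigenvalue_iff_mem_spectrum] at hz
  obtain ⟨x, hx⟩ := hz.exists_hasEigenvector
  have hxe : ∀ i, ∑ j, (A i j : ℂ) * x j = z * x i := fun i => by
    simpa [Matrix.mulVec, dotProduct] using congrFun hx.apply_eq_smul i
  -- The row `i` where the weighted norm of the eigenvector `x` is attained bounds the eigenvalue.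
  obtain ⟨i, -, hi⟩ := Finset.exists_max_image Finset.univ (fun i => ‖x i‖ / v i)
    Finset.univ_nonempty
  set t := ‖x i‖ / v i
  have hxt : ∀ j, ‖x j‖ ≤ t * v j := fun j => (div_le_iff₀ (hv j)).1 (hi j (Finset.mem_univ j))
  have ht : 0 < t := by
    obtain ⟨j, hj⟩ := Function.ne_iff.1 hx.2
    exact pos_of_mul_pos_left ((norm_pos_iff.2 hj).trans_le (hxt j)) (hv j).le
  have hti : ‖x i‖ = t * v i := (div_mul_cancel₀ _ (hv i).ne').symm
  have key : ‖z‖ * (t * v i) < 1 * (t * v i) := by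
    calc ‖z‖ * (t * v i) = ‖∑ j, (A i j : ℂ) * x j‖ := by rw [hxe, norm_mul, hti]
      _ ≤ ∑ j, A i j * ‖x j‖ := (norm_sum_le _ _).trans_eq <| Finset.sum_congr rfl fun j _ => by
          rw [norm_mul, Complex.norm_real, Real.norm_of_nonneg (hA i j)]
      _ ≤ ∑ j, A i j * (t * v j) :=
          Finset.sum_le_sum fun j _ => mul_le_mul_of_nonneg_left (hxt j) (hA i j)
      _ = t * ∑ j, A i j * v j := by
          rw [Finset.mul_sum]; exact Finset.sum_congr rfl fun j _ => by ring
      _ < 1 * (t * v i) := by rw [one_mul]; exact mul_lt_mul_of_pos_left (h i) ht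
  exact_mod_cast lt_of_mul_lt_mul_right key (mul_pos ht (hv i)).le

/-- If the spectral radius is less than `1`, then by Gelfand's formula some power `A ^ m` has row
sums less than `1`, and the row sums of `1 + A + ⋯ + A ^ (m - 1)` form a positive vector that `A`
strictly decreases. -/
theorem exists_mulVec_lt_of_specRad_lt_one (hA : ∀ i j, 0 ≤ A i j) (h : specRad A < 1) :
    ∃ v : n → ℝ, (∀ i, 0 < v i) ∧ ∀ i, ∑ j, A i j * v j < v i := by
  have hpow : ∀ k i j, 0 ≤ (A ^ k) i j := by
    intro k
    induction k with
    | zero => intro i j; rw [pow_zero, Matrix.one_apply]; split_ifs <;> simp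
    | succ k ih =>
      intro i j
      rw [pow_succ, Matrix.mul_apply]
      exact Finset.sum_nonneg fun l _ => mul_nonneg (ih i l) (hA l j)
  -- `m ≠ 0` makes the vector positive: the term `A ^ 0` of the sum has row sums `1`.
  obtain ⟨m, hm1, hm0⟩ := (((spectrum.pow_nnnorm_pow_one_div_tendsto_nhds_spectralRadius
    (A.map (algebraMap ℝ ℂ))).eventually_lt_const h).and
      (Filter.eventually_gt_atTop 0)).exists
  have hnorm : ‖(A.map (algebraMap ℝ ℂ)) ^ m‖₊ < 1 := by
    by_contra! hge
    refine hm1.not_ge (ENNReal.one_le_rpow (mod_cast hge) ?_)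
    positivity
  have hrow : ∀ i, ∑ j, (A ^ m) i j < 1 := by
    intro i
    have hmap : (A.map (algebraMap ℝ ℂ)) ^ m = (A ^ m).map (algebraMap ℝ ℂ) :=
      (Matrix.map_pow A (algebraMap ℝ ℂ) m).symm
    rw [hmap, Matrix.linfty_opNNNorm_def] at hnorm
    have h1 := (Finset.le_sup (f := fun i => ∑ j, ‖((A ^ m).map (algebraMap ℝ ℂ)) i j‖₊)
      (Finset.mem_univ i)).trans_lt hnorm
    have h2 : ∑ j, ‖((A ^ m).map (algebraMap ℝ ℂ)) i j‖ < 1 := by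
      simpa only [NNReal.coe_sum, coe_nnnorm, NNReal.coe_one] using NNReal.coe_lt_coe.2 h1
    refine lt_of_eq_of_lt (Finset.sum_congr rfl fun j _ => ?_) h2
    rw [Matrix.map_apply, Complex.coe_algebraMap, Complex.norm_real,
      Real.norm_of_nonneg (hpow m i j)]
  set r : ℕ → n → ℝ := fun k i => ∑ j, (A ^ k) i j with hr
  have hr0 : ∀ i, r 0 i = 1 := fun i => by simp [hr, Matrix.one_apply]
  have hrs : ∀ k i, ∑ j, A i j * r k j = r (k + 1) i := fun k i => by
    simp only [hr, pow_succ', Matrix.mul_apply, Finset.mul_sum]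
    exact Finset.sum_comm
  have hrn : ∀ k i, 0 ≤ r k i := fun k i => Finset.sum_nonneg fun j _ => hpow k i j
  refine ⟨fun i => ∑ k ∈ Finset.range m, r k i, fun i => ?_, fun i => ?_⟩
  · refine zero_lt_one.trans_le ((hr0 i).symm.le.trans ?_)
    exact Finset.single_le_sum (f := fun k => r k i) (fun k _ => hrn k i) (Finset.mem_range.2 hm0)
  -- The sum telescopes: `A` replaces the row sum `1` of `A ^ 0` by the one of `A ^ m`.
  · have h1 : ∑ j, A i j * ∑ k ∈ Finset.range m, r k j = ∑ k ∈ Finset.range m, r (k + 1) i := by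
      simp only [Finset.mul_sum, ← hrs]
      exact Finset.sum_comm
    have h2 := Finset.sum_range_succ (fun k => r k i) m
    rw [Finset.sum_range_succ', hr0] at h2
    have h3 : r m i < 1 := hrow i
    rw [h1]
    linarith

end SpectralRadius

/-! ### Lipschitz constants of identity maps -/

section LipConst

variable {Y : Type*} [MetricSpace Y]

theorem lipConst_nonneg (f : Y → Y) : 0 ≤ lipConst f :=
  Real.sSup_nonneg <| by
    rintro _ ⟨x, y, -, rfl⟩
    positivity

theorem lipConst_id_le_one : lipConst (id : Y → Y) ≤ 1 :=
  Real.sSup_le (by rintro _ ⟨x, y, -, rfl⟩; exact div_self_le_one _) zero_le_one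

theorem lipConst_id_of_subsingleton [Subsingleton Y] : lipConst (id : Y → Y) = 0 := by
  have : lipRatios (id : Y → Y) = ∅ :=
    Set.eq_empty_iff_forall_notMem.2 fun r ⟨x, y, hxy, _⟩ => hxy (Subsingleton.elim x y)
  rw [lipConst, this, Real.sSup_empty]

theorem lipConst_id_of_nontrivial [Nontrivial Y] : lipConst (id : Y → Y) = 1 := by
  obtain ⟨a, b, hab⟩ := exists_pair_ne Y
  refine le_antisymm lipConst_id_le_one (le_csSup bddAbove_lipRatios_id ⟨a, b, hab, ?_⟩)
  exact (div_self (dist_pos.2 hab).ne').symm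

end LipConst

/-! ### Stability matrices -/

namespace DynamicalNetwork

variable {ι : Type*} [Fintype ι] [DecidableEq ι] {X : ι → Type*} [∀ i, MetricSpace (X i)]
  [∀ i, CompleteSpace (X i)]

/-- `Λ` is a nonnegative matrix of Lipschitz constants for the interaction of the network `N`, with
`Λ i j = 0` unless the `j`-th component depends on the variable `x i`. -/
structure IsLipschitzMatrix (N : DynamicalNetwork X) (Λ : Matrix ι ι ℝ) : Prop where
  nonneg : ∀ i j, 0 ≤ Λ i j
  eq_zero : ∀ i j, i ∉ N.idx j → Λ i j = 0
  dist_le : ∀ (j : ι) (x y : ∀ i, X i),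
    dist (N.F j fun i => x i) (N.F j fun i => y i) ≤ ∑ i, Λ i j * dist (x i) (y i)

/-- Stability of a network, freed of spectral radii: the matrix `Λᵀ · diag(L)` is nonnegative, so
its spectral radius is less than `1` exactly when it strictly decreases some positive vector. -/
theorem exists_isStabilityMatrix_iff (N : DynamicalNetwork X) :
    (∃ A, N.IsStabilityMatrix A ∧ specRad A < 1) ↔
      ∃ Λ, N.IsLipschitzMatrix Λ ∧ ∃ v : ι → ℝ, (∀ i, 0 < v i) ∧
        ∀ j, ∑ i, Λ i j * lipConst (N.φ i) * v i < v j := by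
  constructor
  · rintro ⟨_, ⟨Λ, h1, h2, h3, rfl⟩, hA⟩
    obtain ⟨v, hv, h⟩ := exists_mulVec_lt_of_specRad_lt_one (fun i j => by
      rw [Matrix.mul_diagonal]
      exact mul_nonneg (h1 j i) (lipConst_nonneg _)) hA
    exact ⟨Λ, ⟨h1, h2, h3⟩, v, hv, by
      simpa only [Matrix.mul_diagonal, Matrix.transpose_apply] using h⟩
  · rintro ⟨Λ, h, v, hv, hlt⟩
    refine ⟨_, ⟨Λ, h.nonneg, h.eq_zero, h.dist_le, rfl⟩, specRad_lt_one_of_mulVec_lt ?_ hv ?_⟩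
    · intro i j
      rw [Matrix.mul_diagonal]
      exact mul_nonneg (h.nonneg j i) (lipConst_nonneg _)
    · simpa only [Matrix.mul_diagonal, Matrix.transpose_apply] using hlt

end DynamicalNetwork

/-! ### Indices of the expansion -/

section ExpIdx

variable {ι : Type*} {X : ι → Type*} {S : Finset ι} {G : Digraph ι}

/-- The vertex of `S` whose space is the factor of the expansion at the given index: `j` itself for
`j ∈ S`, and the first vertex `ℓ₁` of the branch for an index `(i; γ)`. -/
def ExpIdx.src : ExpIdx G S → S
  | .base j => j
  | .delay γ _ => ⟨γ.src, γ.src_mem⟩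

@[simp] theorem src_along (γ : Branch G S) (k : Fin (γ.mid.length + 1)) :
    (along γ k).src = ⟨γ.src, γ.src_mem⟩ := by
  cases k using Fin.cases <;> rfl

@[simp] theorem along_zero (γ : Branch G S) : along γ 0 = .base ⟨γ.src, γ.src_mem⟩ := rfl

@[simp] theorem along_succ (γ : Branch G S) (k : Fin γ.mid.length) :
    along γ k.succ = .delay γ k := rfl

/-- The identity from the factor at `c` to the space of its source vertex `i`. -/
def pull (c : ExpIdx G S) {i : S} (h : c.src = i) : ExpSpace X c → X i :=
  match c, h with
  | .base _, rfl => fun a => a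
  | .delay _ _, rfl => fun a => a

/-- The identity from the space of the source vertex of `c` to the factor at `c`. -/
def push (c : ExpIdx G S) : X c.src → ExpSpace X c :=
  match c with
  | .base _ => fun a => a
  | .delay _ _ => fun a => a

theorem toSrc_eq_pull (γ : Branch G S) (k : Fin (γ.mid.length + 1))
    (a : ExpSpace X (along γ k)) : toSrc γ k a = pull (along γ k) (src_along γ k) a := by
  cases k using Fin.cases <;> rfl

theorem toSrc_push (γ : Branch G S) (k : Fin (γ.mid.length + 1)) (x : ∀ i : S, X i) :
    toSrc γ k (push (along γ k) (x (along γ k).src)) = x ⟨γ.src, γ.src_mem⟩ := by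
  cases k using Fin.cases <;> rfl

open Classical in
/-- The index of the variable that replaces `x i` in the component of the expansion at `j ∈ S`:
the last index along the branch from `i` to `j`. If there is no such branch, the value is the
index `i`, which keeps the map `i ↦ lastIdx i j` injective. -/
noncomputable def lastIdx (i j : S) : ExpIdx G S :=
  if h : ∃ γ : Branch G S, γ.src = i ∧ γ.tgt = j then along h.choose (Fin.last _) else .base i

@[simp] theorem src_lastIdx (i j : S) : (lastIdx i j : ExpIdx G S).src = i := by
  unfold lastIdx
  split_ifs with h
  · rw [src_along]
    exact Subtype.ext h.choose_spec.1
  · rfl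

theorem lastIdx_injective (j : S) : Function.Injective fun i : S => (lastIdx i j : ExpIdx G S) :=
  Function.LeftInverse.injective (g := ExpIdx.src) fun i => src_lastIdx i j

/-- Here it is used that there is at most one branch between two given vertices of `S`. -/
theorem IsBasicStructuralSet.lastIdx_eq (hS : IsBasicStructuralSet G S) (γ : Branch G S) {j : S}
    (hj : γ.tgt = j) : lastIdx ⟨γ.src, γ.src_mem⟩ j = along γ (Fin.last _) := by
  have h : ∃ δ : Branch G S, δ.src = γ.src ∧ δ.tgt = j := ⟨γ, rfl, hj⟩
  have hb : h.choose = γ := Set.encard_le_one_iff.1 (hS.basic γ.src γ.src_mem j j.2) _ _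
    h.choose_spec ⟨rfl, hj⟩
  have hd : lastIdx ⟨γ.src, γ.src_mem⟩ j = along h.choose (Fin.last _) := dif_pos h
  rw [hd, hb]

open Classical in
/-- The Lipschitz constants of the expansion that are given by Lipschitz constants `Λ` of the
restriction: those in `Λ` for the components at `S`, and `1` for the delay components. -/
noncomputable def expansionMatrix (Λ : Matrix S S ℝ) :
    Matrix (ExpIdx G S) (ExpIdx G S) ℝ := fun d c =>
  match c with
  | .base j => if d = lastIdx d.src j then Λ d.src j else 0
  | .delay γ k => if d = along γ k.castSucc then 1 else 0

theorem expansionMatrix_lastIdx (Λ : Matrix S S ℝ) (i j : S) :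
    expansionMatrix Λ (lastIdx i j : ExpIdx G S) (.base j) = Λ i j := by
  simp [expansionMatrix]

theorem expansionMatrix_along (Λ : Matrix S S ℝ) (γ : Branch G S)
    (k : Fin γ.mid.length) : expansionMatrix Λ (along γ k.castSucc) (.delay γ k) = 1 := by
  simp [expansionMatrix]

/-- The extension of a vector `w` on `S` to the indices of the expansion that grows by
`ε * w ℓ₁` in every step along a branch with first vertex `ℓ₁`. -/
def alongVector (ε : ℝ) (w : S → ℝ) : ExpIdx G S → ℝ
  | .base j => w j
  | .delay γ k => w ⟨γ.src, γ.src_mem⟩ * (1 + ε * (k + 1))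

theorem alongVector_along (ε : ℝ) (w : S → ℝ) (γ : Branch G S)
    (k : Fin (γ.mid.length + 1)) :
    alongVector ε w (along γ k) = w ⟨γ.src, γ.src_mem⟩ * (1 + ε * k) := by
  cases k using Fin.cases <;> simp [alongVector]

theorem alongVector_pos {ε : ℝ} (hε : 0 < ε) {w : S → ℝ} (hw : ∀ i, 0 < w i)
    (c : ExpIdx G S) : 0 < alongVector ε w c := by
  cases c with
  | base j => exact hw j
  | delay γ k => exact mul_pos (hw _) (by positivity)

theorem alongVector_le [Fintype ι] {ε : ℝ} (hε : 0 < ε) {w : S → ℝ} (hw : ∀ i, 0 < w i)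
    (c : ExpIdx G S) : alongVector ε w c ≤ w c.src * (1 + ε * Fintype.card ι) := by
  cases c with
  | base j => exact le_mul_of_one_le_right (hw j).le (le_add_of_nonneg_right (by positivity))
  | delay γ k =>
    refine mul_le_mul_of_nonneg_left ?_ (hw _).le
    gcongr
    exact_mod_cast k.2.trans_le γ.mid_nodup.length_le_card

variable [∀ i, MetricSpace (X i)]

theorem dist_pull (c : ExpIdx G S) {i : S} (h : c.src = i) (a b : ExpSpace X c) :
    dist (pull c h a) (pull c h b) = dist a b := by
  cases c <;> cases h <;> rfl

theorem dist_push (c : ExpIdx G S) (a b : X c.src) : dist (push c a) (push c b) = dist a b := by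
  cases c <;> rfl

theorem dist_toSrc (γ : Branch G S) (k : Fin (γ.mid.length + 1))
    (a b : ExpSpace X (along γ k)) : dist (toSrc γ k a) (toSrc γ k b) = dist a b := by
  rw [toSrc_eq_pull, toSrc_eq_pull, dist_pull]

theorem lipConst_id_expSpace (c : ExpIdx G S) :
    lipConst (id : ExpSpace X c → ExpSpace X c) = lipConst (id : X c.src → X c.src) := by
  cases c <;> rfl

end ExpIdx

/-! ### Comparison of the restriction and the expansion -/

namespace DynamicalNetwork

variable {ι : Type*} [Fintype ι] [DecidableEq ι] {X : ι → Type*} [∀ i, MetricSpace (X i)]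
  [∀ i, CompleteSpace (X i)] {N : DynamicalNetwork X} {S : Finset ι}

/-- For a basic structural set, the component of the expansion at `j ∈ S` is the component of the
restriction, with `x i` read off from the last index along the branch from `i` to `j`. -/
theorem expansion_F_base (hS : IsBasicStructuralSet N.graph S) (j : S)
    (x : ∀ c : ExpIdx N.graph S, ExpSpace X c) :
    (N.expansion hS.toIsCompleteStructuralSet).F (.base j) (fun c => x c) =
      (N.restriction hS.toIsCompleteStructuralSet).F j
        (fun i => pull (lastIdx i j) (src_lastIdx _ _) (x (lastIdx i j))) := by
  change N.subst _ j j.2 _ = N.subst _ j j.2 _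
  congr 1
  funext γ h
  have key : ∀ (c : ExpIdx N.graph S) (hc : c.src = ⟨γ.src, γ.src_mem⟩),
      c = along γ (Fin.last _) →
      toSrc γ (Fin.last _) (x (along γ (Fin.last _))) = pull c hc (x c) := by
    rintro _ hc rfl
    exact toSrc_eq_pull _ _ _
  exact key _ _ (hS.lastIdx_eq γ h)

/-- On states all of whose delayed variables agree with the undelayed ones, the expansion acts as
the restriction. -/
theorem expansion_F_base_push (hS : IsCompleteStructuralSet N.graph S) (j : S)
    (x : ∀ i : S, X i) :
    (N.expansion hS).F (.base j) (fun c => push c.1 (x c.1.src)) =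
      (N.restriction hS).F j (fun i => x i) := by
  change N.subst _ j j.2 _ = N.subst _ j j.2 _
  congr 1
  funext γ h
  exact toSrc_push γ _ x

/-- In the row of the expansion that belongs to `j ∈ S`, only the indices `lastIdx i j` count. -/
theorem sum_lastIdx (hS : IsBasicStructuralSet N.graph S) {j : S} {f : ExpIdx N.graph S → ℝ}
    (hf : ∀ c, c ∉ (N.expansion hS.toIsCompleteStructuralSet).idx (.base j) → f c = 0) :
    ∑ i : S, f (lastIdx i j) = ∑ c, f c := by
  refine Fintype.sum_of_injective _ (lastIdx_injective j) _ _ (fun c hc => hf c ?_) fun _ => rfl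
  rintro ⟨γ, hγ, rfl⟩
  exact hc ⟨_, hS.lastIdx_eq γ hγ⟩

theorem sum_along {hS : IsCompleteStructuralSet N.graph S} {γ : Branch N.graph S}
    {k : Fin γ.mid.length} {f : ExpIdx N.graph S → ℝ}
    (hf : ∀ c, c ∉ (N.expansion hS).idx (.delay γ k) → f c = 0) :
    ∑ c, f c = f (along γ k.castSucc) :=
  Fintype.sum_eq_single _ fun c hc => hf c hc

/-! ### From the expansion to the restriction -/

section OfExpansion

variable {hS : IsCompleteStructuralSet N.graph S}
  {Λ : Matrix (ExpIdx N.graph S) (ExpIdx N.graph S) ℝ}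
  [Nonempty (∀ i : S, X i)]

/-- A delay component of the expansion is an isometry in its only variable, so its Lipschitz
constant is at least `1`, unless the variable takes at most one value. -/
theorem IsLipschitzMatrix.one_le_delay (hΛ : (N.expansion hS).IsLipschitzMatrix Λ)
    (γ : Branch N.graph S) [Nontrivial (X γ.src)] (k : Fin γ.mid.length) :
    1 ≤ Λ (along γ k.castSucc) (.delay γ k) := by
  obtain ⟨z⟩ := ‹Nonempty (∀ i : S, X i)›
  obtain ⟨a, b, hab⟩ := exists_pair_ne (X γ.src)
  -- `w t` has the value `t` at every copy of the space of the first vertex of `γ`. Only one of the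
  -- variables in which `w a` and `w b` differ is a variable of the delay component.
  let w : X γ.src → ∀ c : ExpIdx N.graph S, ExpSpace X c :=
    fun t c => push c (Function.update z ⟨γ.src, γ.src_mem⟩ t c.src)
  have hw : ∀ t, (N.expansion hS).F (.delay γ k) (fun c => w t c) = t := fun t =>
    (toSrc_push γ k.castSucc (Function.update z ⟨γ.src, γ.src_mem⟩ t)).trans
      (Function.update_self ..)
  have hd : dist (w a (along γ k.castSucc)) (w b (along γ k.castSucc)) = dist a b := by
    rw [← dist_toSrc, toSrc_push, toSrc_push, Function.update_self, Function.update_self]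
  have h := hΛ.dist_le (.delay γ k) (w a) (w b)
  rw [hw, hw, sum_along fun c hc => by rw [hΛ.eq_zero _ _ hc, zero_mul], hd] at h
  exact (le_mul_iff_one_le_left (dist_pos.2 hab)).1 h

/-- A positive vector that is strictly decreased by a stability matrix of the expansion does not
decrease along a branch whose delayed variables take at least two values. -/
theorem IsLipschitzMatrix.base_le_along (hΛ : (N.expansion hS).IsLipschitzMatrix Λ)
    {v : ExpIdx N.graph S → ℝ} (hv : ∀ c, 0 < v c)
    (hlt : ∀ c, ∑ d, Λ d c * lipConst ((N.expansion hS).φ d) * v d < v c)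
    (γ : Branch N.graph S) [Nontrivial (X γ.src)] (k : Fin (γ.mid.length + 1)) :
    v (.base ⟨γ.src, γ.src_mem⟩) ≤ v (along γ k) := by
  induction k using Fin.induction with
  | zero => exact le_rfl
  | succ k ih =>
    have hL : lipConst ((N.expansion hS).φ (along γ k.castSucc)) = 1 := by
      refine (lipConst_id_expSpace (along γ k.castSucc)).trans ?_
      rw [src_along]
      exact lipConst_id_of_nontrivial
    have h := hlt (.delay γ k)
    rw [sum_along fun c hc => by rw [hΛ.eq_zero _ _ hc, zero_mul, zero_mul], hL, mul_one] at h
    exact ih.trans ((le_mul_of_one_le_left (hv _).le (hΛ.one_le_delay γ k)).trans h.le)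

end OfExpansion

/-- Lipschitz constants of the expansion for the variables that replace the `x i` are Lipschitz
constants of the restriction. -/
theorem IsLipschitzMatrix.restriction (hS : IsBasicStructuralSet N.graph S)
    {Λ : Matrix (ExpIdx N.graph S) (ExpIdx N.graph S) ℝ}
    (hΛ : (N.expansion hS.toIsCompleteStructuralSet).IsLipschitzMatrix Λ) :
    (N.restriction hS.toIsCompleteStructuralSet).IsLipschitzMatrix
      fun i j => Λ (lastIdx i j) (.base j) where
  nonneg i j := hΛ.nonneg _ _
  eq_zero i j hij := hΛ.eq_zero _ _ <| by
    rintro ⟨γ, hγ, h⟩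
    have hsrc := congrArg ExpIdx.src h
    rw [src_lastIdx, src_along] at hsrc
    exact hij ⟨γ, congrArg Subtype.val hsrc.symm, hγ⟩
  dist_le j x y := by
    have h := hΛ.dist_le (.base j) (fun c => push c (x c.src)) (fun c => push c (y c.src))
    rw [expansion_F_base_push, expansion_F_base_push,
      ← sum_lastIdx hS fun c hc => by rw [hΛ.eq_zero _ _ hc, zero_mul]] at h
    refine h.trans_eq (Finset.sum_congr rfl fun i _ => ?_)
    rw [dist_push, src_lastIdx]

theorem restriction_stable_of_expansion_stable (hS : IsBasicStructuralSet N.graph S)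
    (h : ∃ A, (N.expansion hS.toIsCompleteStructuralSet).IsStabilityMatrix A ∧ specRad A < 1) :
    ∃ B, (N.restriction hS.toIsCompleteStructuralSet).IsStabilityMatrix B ∧ specRad B < 1 := by
  rw [exists_isStabilityMatrix_iff] at h ⊢
  rcases isEmpty_or_nonempty (∀ i : S, X i) with hX | hX
  -- On an empty space every interaction has the Lipschitz constants `0`.
  · exact ⟨0, ⟨fun _ _ => le_rfl, fun _ _ _ => rfl, fun _ x => hX.elim x⟩, 1,
      fun _ => zero_lt_one, fun j => by simp⟩
  obtain ⟨Λ, hΛ, v, hv, hlt⟩ := h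
  refine ⟨_, hΛ.restriction hS, fun i => v (.base i), fun i => hv _, fun j => ?_⟩
  refine lt_of_le_of_lt ?_ (hlt (.base j))
  rw [← sum_lastIdx hS fun c hc => by rw [hΛ.eq_zero _ _ hc, zero_mul, zero_mul]]
  refine Finset.sum_le_sum fun i _ => ?_
  have hL : lipConst ((N.expansion hS.toIsCompleteStructuralSet).φ (lastIdx i j)) =
      lipConst (id : X i → X i) := by
    refine (lipConst_id_expSpace (lastIdx i j)).trans ?_
    rw [src_lastIdx]
  rw [hL]
  change _ * lipConst (id : X i → X i) * _ ≤ _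
  rcases subsingleton_or_nontrivial (X i) with hXi | hXi
  · simp [lipConst_id_of_subsingleton]
  refine mul_le_mul_of_nonneg_left ?_ (mul_nonneg (hΛ.nonneg _ _) (lipConst_nonneg _))
  by_cases hij : ∃ γ : Branch N.graph S, γ.src = i ∧ γ.tgt = j
  · obtain ⟨γ, hi, hj⟩ := hij
    obtain rfl : (⟨γ.src, γ.src_mem⟩ : S) = i := Subtype.ext hi
    have : Nontrivial (X γ.src) := hXi
    rw [hS.lastIdx_eq γ hj]
    exact hΛ.base_le_along hv hlt γ _
  · rw [lastIdx, dif_neg hij]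

/-! ### From the restriction to the expansion -/

theorem expansionMatrix_eq_zero {hS : IsCompleteStructuralSet N.graph S} {Λ : Matrix S S ℝ}
    (hΛ : (N.restriction hS).IsLipschitzMatrix Λ) {d c : ExpIdx N.graph S}
    (h : d ∉ (N.expansion hS).idx c) : expansionMatrix Λ d c = 0 := by
  cases c with
  | base j =>
    refine ite_eq_right_iff.2 fun hd => hΛ.eq_zero _ _ fun hij => h ?_
    have hij' : ∃ γ : Branch N.graph S, γ.src = d.src ∧ γ.tgt = j := hij
    refine ⟨hij'.choose, hij'.choose_spec.2, hd.trans ?_⟩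
    rw [lastIdx, dif_pos hij']
  | delay γ k => exact if_neg h

theorem IsLipschitzMatrix.expansion (hS : IsBasicStructuralSet N.graph S) {Λ : Matrix S S ℝ}
    (hΛ : (N.restriction hS.toIsCompleteStructuralSet).IsLipschitzMatrix Λ) :
    (N.expansion hS.toIsCompleteStructuralSet).IsLipschitzMatrix
      (expansionMatrix Λ) where
  nonneg d c := by
    cases c <;> dsimp only [expansionMatrix] <;> split_ifs <;> simp [hΛ.nonneg]
  eq_zero d c h := expansionMatrix_eq_zero hΛ h
  dist_le c x y := by
    cases c with
    | base j =>
      rw [expansion_F_base hS, expansion_F_base hS,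
        ← sum_lastIdx hS fun c hc => by rw [expansionMatrix_eq_zero hΛ hc, zero_mul]]
      refine (hΛ.dist_le j (fun i => pull (lastIdx i j) (src_lastIdx _ _) (x _))
        (fun i => pull (lastIdx i j) (src_lastIdx _ _) (y _))).trans_eq
          (Finset.sum_congr rfl fun i _ => ?_)
      rw [dist_pull, expansionMatrix_lastIdx]
    | delay γ k =>
      rw [sum_along fun c hc => by rw [expansionMatrix_eq_zero hΛ hc, zero_mul],
        expansionMatrix_along, one_mul]
      exact (dist_toSrc γ k.castSucc _ _).le

theorem expansion_stable_of_restriction_stable (hS : IsBasicStructuralSet N.graph S)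
    (h : ∃ B, (N.restriction hS.toIsCompleteStructuralSet).IsStabilityMatrix B ∧ specRad B < 1) :
    ∃ A, (N.expansion hS.toIsCompleteStructuralSet).IsStabilityMatrix A ∧ specRad A < 1 := by
  rw [exists_isStabilityMatrix_iff] at h ⊢
  obtain ⟨Λ, hΛ, w, hw, hlt⟩ := h
  set L : S → ℝ := fun i => lipConst (id : X i → X i)
  change ∀ j, ∑ i, Λ i j * L i * w i < w j at hlt
  -- `1 + ε * card ι` bounds the growth along every branch, since interior vertices are distinct.
  obtain ⟨ε, hε, hεlt⟩ : ∃ ε : ℝ, 0 < ε ∧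
      ∀ j, (∑ i, Λ i j * L i * w i) * (1 + ε * Fintype.card ι) < w j := by
    have hev : ∀ᶠ ε in nhdsWithin (0 : ℝ) (Set.Ioi 0),
        ∀ j, (∑ i, Λ i j * L i * w i) * (1 + ε * Fintype.card ι) < w j := by
      refine Filter.eventually_all.2 fun j => nhdsWithin_le_nhds ?_
      refine ContinuousAt.eventually_lt (by fun_prop) continuousAt_const ?_
      simpa using hlt j
    obtain ⟨ε, h1, h2⟩ := (hev.and self_mem_nhdsWithin).exists
    exact ⟨ε, h2, h1⟩
  have hL : ∀ c, lipConst ((N.expansion hS.toIsCompleteStructuralSet).φ c) = L c.src :=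
    lipConst_id_expSpace
  refine ⟨_, hΛ.expansion hS, alongVector ε w, alongVector_pos hε hw, fun c => ?_⟩
  cases c with
  | base j =>
    rw [← sum_lastIdx hS fun c hc => by rw [expansionMatrix_eq_zero hΛ hc, zero_mul, zero_mul]]
    refine lt_of_le_of_lt ?_ (hεlt j)
    rw [Finset.sum_mul]
    refine Finset.sum_le_sum fun i _ => ?_
    rw [expansionMatrix_lastIdx, hL, src_lastIdx, mul_assoc (Λ i j * L i)]
    refine mul_le_mul_of_nonneg_left ?_ (mul_nonneg (hΛ.nonneg i j) (lipConst_nonneg _))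
    simpa using alongVector_le hε hw (lastIdx i j : ExpIdx N.graph S)
  | delay γ k =>
    rw [sum_along fun c hc => by rw [expansionMatrix_eq_zero hΛ hc, zero_mul, zero_mul],
      expansionMatrix_along, one_mul, hL]
    refine (mul_le_of_le_one_left (alongVector_pos hε hw _).le lipConst_id_le_one).trans_lt ?_
    rw [← along_succ, alongVector_along, alongVector_along]
    refine mul_lt_mul_of_pos_left ?_ (hw _)
    gcongr
    exact Fin.castSucc_lt_succ

end DynamicalNetwork

end Delay

theorem theorem6p5 {ι : Type*} [Fintype ι] [DecidableEq ι] {X : ι → Type*}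
    [∀ i, MetricSpace (X i)] [∀ i, CompleteSpace (X i)]
    (N : Delay.DynamicalNetwork X) (S : Finset ι)
    (hS : Delay.IsBasicStructuralSet N.graph S) :
    (∃ A, (N.expansion hS.toIsCompleteStructuralSet).IsStabilityMatrix A ∧
        Delay.specRad A < 1) ↔
      ∃ B, (N.restriction hS.toIsCompleteStructuralSet).IsStabilityMatrix B ∧
        Delay.specRad B < 1 :=
  ⟨N.restriction_stable_of_expansion_stable hS, N.expansion_stable_of_restriction_stable hS⟩
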